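/- Let $k$ be a field, $n\ge 0$ an integer, and let $\Lambda$ be the exterior algebra over $k$ in $n$ variables. A $\Lambda$-module finitely generated in degree zero is a finitely generated graded left $\Lambda$-module $M=\bigoplus_{i\ge 0}M_i$ which is generated by $M_0$ and is also a right $\Lambda$-module with $am=(-1)^{\deg a\,\deg m}\,ma$ for homogeneous $a\in\Lambda$, $m\in M$. Its Hilbert function is $H_M(i)=\dim_k M_i$ for $i\in\mathbb N$. Let $C\subseteq\mathbb R^{\mathbb N}$ be the convex cone spanned by the Hilbert functions of all such modules. Then $C$ is simplicial, that is, it is the set of non-negative linear combinations of finitely many linearly independent vectors. Moreover, a sequence $h\in\mathbb R^{\mathbb N}$ belongs to $C$ if and only if $h(i)=0$ for all $i>n$, $h(n)\ge 0$, and $$\frac{h(i+1)}{\binom n{i+1}}\le\frac{h(i)}{\binom ni}\qquad\text{for } 0\le i<n .$$ None of these $n$ inequalities can be omitted: for each $i$ with $0\le i<n$ there is a non-negative sequence $h\notin C$, vanishing in all degrees $>n$, that satisfies all the others. The same cone $C$ is obtained if only $\mathbb N^n$-graded modules are considered, where $\Lambda$ carries its natural $\mathbb N^n$-grading, $M=\bigoplus_{a\in\mathbb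 N^n}M_a$ is generated in degree $0\in\mathbb N^n$, degrees in the sign rule are total degrees, and $M_i=\bigoplus_{a_1+\cdots+a_n=i}M_a$. -/

import Mathlib

open MulOpposite

universe u

/-- The exterior algebra `Λ` in `n` variables over the field `k`. -/
abbrev ExtAlg (k : Type u) [Field k] (n : ℕ) : Type u :=
  ExteriorAlgebra k (Fin n → k)

/-- The standard `ℕ`-grading of `Λ`: the component of degree `i` is the `i`-th exterior power. -/
def stdGrading (k : Type u) [Field k] (n : ℕ) : ℕ → Submodule k (ExtAlg k n) :=
  fun i => ⋀[k]^i (Fin n → k)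

/-- The natural `ℕⁿ`-grading of `Λ`: the component of degree `a` is spanned by all products
`e_{l₁} ∧ ⋯ ∧ e_{lᵣ}` of variables in which the variable `e_j` occurs exactly `a j` times
(so it is zero unless `a` is squarefree). -/
def fineGrading (k : Type u) [Field k] (n : ℕ) : (Fin n → ℕ) → Submodule k (ExtAlg k n) :=
  fun a => Submodule.span k
    {x | ∃ l : List (Fin n), (∀ j, l.count j = a j) ∧
      x = (l.map fun j => ExteriorAlgebra.ι k (Pi.single j (1 : k) : Fin n → k)).prod}

/-- The total degree `|a| = a₁ + ⋯ + aₙ` of `a ∈ ℕⁿ`. -/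
def totalDegree (n : ℕ) (a : Fin n → ℕ) : ℕ := ∑ j, a j

/-- `𝓜` makes the left and right `Λ`-module `M` a `G`-graded `Λ`-module, where `𝓐` is the
`G`-grading of `Λ` and `deg : G → ℕ` gives the total degree.  The right action of `a` on `m` is
`op a • m`, and the two actions satisfy `a m = (-1)^(deg a * deg m) m a` on homogeneous elements. -/
structure IsGradedModule {k : Type u} [Field k] {n : ℕ} {G : Type} [AddCommMonoid G]
    [DecidableEq G] (deg : G → ℕ) (𝓐 : G → Submodule k (ExtAlg k n))
    {M : Type u} [AddCommGroup M] [Module k M] [Module (ExtAlg k n) M]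
    [Module (ExtAlg k n)ᵐᵒᵖ M] (𝓜 : G → Submodule k M) : Prop where
  isInternal : DirectSum.IsInternal 𝓜
  smul_mem : ∀ (g h : G), ∀ a ∈ 𝓐 g, ∀ m ∈ 𝓜 h, a • m ∈ 𝓜 (g + h)
  smul_comm : ∀ (g h : G), ∀ a ∈ 𝓐 g, ∀ m ∈ 𝓜 h,
    a • m = (-1 : ℤ) ^ (deg g * deg h) • (op a • m)

/-- The module is generated, over `Λ`, by its elements of degree zero. -/
def IsGeneratedInDegreeZero {k : Type u} [Field k] {n : ℕ} {G : Type} [AddCommMonoid G]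
    {M : Type u} [AddCommGroup M] [Module k M] [Module (ExtAlg k n) M]
    (𝓜 : G → Submodule k M) : Prop :=
  Submodule.span (ExtAlg k n) (𝓜 0 : Set M) = ⊤

/-- The coarse Hilbert function `H_M(i) = dim_k M_i`, where `M_i` is the sum of the components
whose total degree is `i`.  Its values are regarded as real numbers. -/
noncomputable def hilbertFunction {k : Type u} [Field k] {G : Type} (deg : G → ℕ)
    {M : Type u} [AddCommGroup M] [Module k M] (𝓜 : G → Submodule k M) : ℕ → ℝ :=
  fun i => (Module.finrank k (⨆ (g : G) (_ : deg g = i), 𝓜 g : Submodule k M) : ℝ)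

/-- The set of Hilbert functions of the graded `Λ`-modules, with respect to the grading `𝓐` of
`Λ`, that are finitely generated in degree zero. -/
def hilbertFunctions {k : Type u} [Field k] {n : ℕ} {G : Type} [AddCommMonoid G]
    [DecidableEq G] (deg : G → ℕ) (𝓐 : G → Submodule k (ExtAlg k n)) : Set (ℕ → ℝ) :=
  {h | ∃ (M : Type u) (_ : AddCommGroup M) (_ : Module k M) (_ : Module (ExtAlg k n) M)
      (_ : IsScalarTower k (ExtAlg k n) M) (_ : Module (ExtAlg k n)ᵐᵒᵖ M)
      (𝓜 : G → Submodule k M),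
    IsGradedModule deg 𝓐 𝓜 ∧ Module.Finite (ExtAlg k n) M ∧
      IsGeneratedInDegreeZero (n := n) 𝓜 ∧ h = hilbertFunction deg 𝓜}

/-- The cone in `ℝ^ℕ` spanned by the Hilbert functions of the `ℕ`-graded `Λ`-modules that are
finitely generated in degree zero. -/
noncomputable def hilbertCone (k : Type u) [Field k] (n : ℕ) : PointedCone ℝ (ℕ → ℝ) :=
  PointedCone.hull ℝ (hilbertFunctions (fun i : ℕ => i) (stdGrading k n))

/-- The cone in `ℝ^ℕ` spanned by the (coarse) Hilbert functions of the `ℕⁿ`-graded `Λ`-modules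
that are finitely generated in degree zero. -/
noncomputable def fineHilbertCone (k : Type u) [Field k] (n : ℕ) : PointedCone ℝ (ℕ → ℝ) :=
  PointedCone.hull ℝ (hilbertFunctions (totalDegree n) (fineGrading k n))

/-- The `i`-th linear inequality `h(i+1) / C(n,i+1) ≤ h(i) / C(n,i)`; it is used for `i < n`. -/
def GrowthInequality (n i : ℕ) (h : ℕ → ℝ) : Prop :=
  h (i + 1) / (n.choose (i + 1) : ℝ) ≤ h i / (n.choose i : ℝ)

/-!
The cone of Hilbert functions is squeezed between two explicit cones that coincide.

*Upper bound.*  Let `M` be an `ℕ`-graded module generated in degree zero and let `m_l` be a basis of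
`M_0`.  Then `M_i` is spanned by the products `e_S m_l` with `|S| = i`, where `e_S` are the squarefree
monomials (`IsGradedModule.eq_span_monomialBasis_smul`).  Order these products by a monomial order
and call `e_S m_l` standard if it is not in the span of the preceding products of the same degree;
the standard products of degree `i` are counted by `dim M_i`
(`finrank_span_eq_sum_card_notMem_lowerSpan`).  If `e_S m_l` is standard and `j ∈ S`, then
`e_{S \ j} m_l` is standard, because a relation for the latter can be multiplied by `e_j`
(`notMem_lowerSpan_erase`).  For every `l` the standard sets `S` of size `i` thus contain the shadow
of those of size `i + 1`, and the local LYM inequality gives the growth inequality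
(`finrank_span_div_choose_le`).  This replaces the passage to an initial submodule.

*Lower bound.*  The quotient of `Λ` by all monomials of degree greater than `d` is `ℕⁿ`-graded, and
its Hilbert function is the row `C(n,0), …, C(n,d)` of Pascal's triangle truncated after degree `d`
(`truncatedBinomial_mem_hilbertFunctions`).  Since every `ℕⁿ`-graded module is `ℕ`-graded by total
degree (`IsGradedModule.coarsen`), these sequences lie in both cones.

*Comparison.*  By summation by parts, a sequence that satisfies the inequalities is the combination
of the `n + 1` truncated rows whose coefficients are the differences of consecutive terms
`h(d) / C(n,d)` (`eq_sum_growthDefect_smul`).  The functionals computing these differences are dual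
to the truncated rows, which are therefore linearly independent.
-/

/-! ### Monomials in the exterior algebra -/

section Monomials

variable {k : Type u} [Field k] {n : ℕ}

/-- The variable `e_j` of the exterior algebra. -/
noncomputable def extVar (k : Type u) [Field k] {n : ℕ} (j : Fin n) : ExtAlg k n :=
  ExteriorAlgebra.ι k (Pi.single j (1 : k) : Fin n → k)

/-- The basis of the exterior algebra formed by the squarefree monomials `e_S`, the product of the
variables `e_j` with `j ∈ S` taken in increasing order. -/
noncomputable def monomialBasis (k : Type u) [Field k] (n : ℕ) :
    Module.Basis (Finset (Fin n)) k (ExtAlg k n) :=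
  (Pi.basisFun k (Fin n)).ExteriorAlgebra

lemma monomialBasis_empty : monomialBasis k n ∅ = 1 := by
  rw [monomialBasis, ExteriorAlgebra.basis_apply_ofCard _ Finset.card_empty,
    ExteriorAlgebra.ιMulti_family, ExteriorAlgebra.ιMulti_zero_apply]

lemma monomialBasis_singleton (j : Fin n) : monomialBasis k n {j} = extVar k j := by
  rw [monomialBasis, ExteriorAlgebra.basis_apply_ofCard _ (Finset.card_singleton j),
    ExteriorAlgebra.ιMulti_family, ExteriorAlgebra.ιMulti_apply]
  have h : ∀ i, Set.powersetCard.ofFinEmbEquiv.symm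
      (Set.powersetCard.ofCard (Finset.card_singleton j)) i = j := by
    intro i
    have := (Set.powersetCard.mem_range_ofFinEmbEquiv_symm_iff_mem
      (Set.powersetCard.ofCard (Finset.card_singleton j)) _).1 ⟨i, rfl⟩
    rw [← Set.powersetCard.mem_coe_iff, Set.powersetCard.val_ofCard] at this
    simpa using this
  simp [h, extVar]

lemma extVar_mul_monomialBasis_of_mem {j : Fin n} {S : Finset (Fin n)} (h : j ∈ S) :
    extVar k j * monomialBasis k n S = 0 := by
  rw [← monomialBasis_singleton]
  exact ExteriorAlgebra.basis_mul_of_not_disjoint (Pi.basisFun k (Fin n))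
    (Set.powersetCard.ofCard (Finset.card_singleton j)) (Set.powersetCard.ofCard (s := S) rfl)
    (by simpa using h)

lemma extVar_mul_monomialBasis_of_notMem {j : Fin n} {S : Finset (Fin n)} (h : j ∉ S) :
    ∃ u : ℤˣ, extVar k j * monomialBasis k n S = u • monomialBasis k n (insert j S) := by
  have hd : Disjoint (Set.powersetCard.ofCard (Finset.card_singleton j)).val
      (Set.powersetCard.ofCard (s := S) rfl).val := by simpa using h
  refine ⟨Equiv.Perm.sign (Set.powersetCard.permOfDisjoint hd), ?_⟩
  rw [← monomialBasis_singleton]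
  refine (ExteriorAlgebra.basis_mul_of_disjoint (Pi.basisFun k (Fin n))
    (Set.powersetCard.ofCard (Finset.card_singleton j)) (Set.powersetCard.ofCard (s := S) rfl)
    hd).trans ?_
  congr 2
  rw [Set.powersetCard.coe_disjUnion]
  ext; simp

lemma prod_extVar_of_nodup {l : List (Fin n)} (h : l.Nodup) :
    ∃ u : ℤˣ, (l.map fun j => extVar k j).prod = u • monomialBasis k n l.toFinset := by
  induction l with
  | nil => exact ⟨1, by simp [monomialBasis_empty]⟩
  | cons j l ih =>
    rw [List.nodup_cons] at h
    obtain ⟨u, hu⟩ := ih h.2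
    obtain ⟨v, hv⟩ := extVar_mul_monomialBasis_of_notMem (k := k) (S := l.toFinset) (j := j)
      (by simpa using h.1)
    refine ⟨u * v, ?_⟩
    rw [List.map_cons, List.prod_cons, hu, mul_smul_comm, hv, smul_smul, List.toFinset_cons]

lemma prod_extVar_eq_zero {l : List (Fin n)} (h : ¬ l.Nodup) :
    (l.map fun j => extVar k j).prod = 0 := by
  induction l with
  | nil => simp at h
  | cons j l ih =>
    rw [List.map_cons, List.prod_cons]
    by_cases hl : l.Nodup
    · have hj : j ∈ l := by simpa [hl] using h
      obtain ⟨u, hu⟩ := prod_extVar_of_nodup (k := k) hl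
      rw [hu, mul_smul_comm, extVar_mul_monomialBasis_of_mem (by simpa using hj), smul_zero]
    · rw [ih hl, mul_zero]

/-- The degree in `ℕⁿ` of the monomial `e_S`. -/
def fineDegree {n : ℕ} (S : Finset (Fin n)) : Fin n → ℕ := fun j => if j ∈ S then 1 else 0

lemma totalDegree_fineDegree (S : Finset (Fin n)) : totalDegree n (fineDegree S) = S.card := by
  simp [totalDegree, fineDegree]

lemma count_eq_fineDegree {l : List (Fin n)} (h : l.Nodup) (j : Fin n) :
    l.count j = fineDegree l.toFinset j := by
  simp [fineDegree, List.Nodup.count h]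

lemma units_smul_mem {V : Type*} [AddCommGroup V] [Module k V] {N : Submodule k V} (u : ℤˣ)
    {x : V} : u • x ∈ N ↔ x ∈ N := by
  rcases Int.units_eq_one_or u with rfl | rfl <;> simp

lemma fineGrading_eq_span (a : Fin n → ℕ) :
    fineGrading k n a = Submodule.span k (monomialBasis k n '' {S | fineDegree S = a}) := by
  apply le_antisymm
  · refine Submodule.span_le.2 ?_
    rintro _ ⟨l, hl, rfl⟩
    by_cases h : l.Nodup
    · obtain ⟨u, hu⟩ := prod_extVar_of_nodup (k := k) h
      have hmem : monomialBasis k n l.toFinset ∈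
          Submodule.span k (monomialBasis k n '' {S | fineDegree S = a}) :=
        Submodule.subset_span ⟨_, funext fun j => by
          rw [← hl, count_eq_fineDegree h], rfl⟩
      change (l.map fun j => extVar k j).prod ∈ Submodule.span k _
      rw [hu]
      exact (units_smul_mem u).2 hmem
    · change (l.map fun j => extVar k j).prod ∈ Submodule.span k _
      rw [prod_extVar_eq_zero h]
      exact zero_mem _
  · refine Submodule.span_le.2 ?_
    rintro _ ⟨S, rfl, rfl⟩
    obtain ⟨u, hu⟩ := prod_extVar_of_nodup (k := k) S.nodup_toList
    rw [Finset.toList_toFinset] at hu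
    refine (units_smul_mem u).1 ?_
    rw [← hu]
    refine Submodule.subset_span ⟨S.toList, fun j => ?_, rfl⟩
    rw [count_eq_fineDegree S.nodup_toList, Finset.toList_toFinset]

lemma stdGrading_eq_span (i : ℕ) :
    stdGrading k n i = Submodule.span k (monomialBasis k n '' {S | S.card = i}) := by
  have h := congrArg (Submodule.map (stdGrading k n i).subtype)
    ((Pi.basisFun k (Fin n)).exteriorPower i).span_eq
  replace h := h.trans ((Submodule.map_top _).trans (Submodule.range_subtype _))
  rw [← h]
  refine (Submodule.map_span _ _).trans ?_
  congr 1
  ext x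
  constructor
  · rintro ⟨_, ⟨S, rfl⟩, rfl⟩
    exact ⟨S, S.2, ExteriorAlgebra.basis_eq_coe_basis _ _⟩
  · rintro ⟨S, hS, rfl⟩
    exact ⟨_, ⟨Set.powersetCard.ofCard hS, rfl⟩,
      (ExteriorAlgebra.basis_eq_coe_basis _ (Set.powersetCard.ofCard hS)).symm⟩

lemma monomialBasis_mem_stdGrading (S : Finset (Fin n)) :
    monomialBasis k n S ∈ stdGrading k n S.card := by
  rw [stdGrading_eq_span]
  exact Submodule.subset_span ⟨S, rfl, rfl⟩

lemma fineGrading_le_stdGrading (a : Fin n → ℕ) :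
    fineGrading k n a ≤ stdGrading k n (totalDegree n a) := by
  rw [fineGrading_eq_span, Submodule.span_le]
  rintro _ ⟨S, rfl, rfl⟩
  rw [totalDegree_fineDegree]
  exact monomialBasis_mem_stdGrading S

lemma stdGrading_le_iSup_fineGrading (i : ℕ) :
    stdGrading k n i ≤ ⨆ (a : Fin n → ℕ) (_ : totalDegree n a = i), fineGrading k n a := by
  rw [stdGrading_eq_span, Submodule.span_le]
  rintro _ ⟨S, rfl, rfl⟩
  refine Submodule.mem_iSup_of_mem (fineDegree S) (Submodule.mem_iSup_of_mem
    (totalDegree_fineDegree S) ?_)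
  rw [fineGrading_eq_span]
  exact Submodule.subset_span ⟨S, rfl, rfl⟩

lemma mul_mem_fineGrading {a b : Fin n → ℕ} {x y : ExtAlg k n} (hx : x ∈ fineGrading k n a)
    (hy : y ∈ fineGrading k n b) : x * y ∈ fineGrading k n (a + b) := by
  have h : x * y ∈ fineGrading k n a * fineGrading k n b := Submodule.mul_mem_mul hx hy
  rw [fineGrading, fineGrading, Submodule.span_mul_span] at h
  refine Submodule.span_mono ?_ h
  rintro _ ⟨_, ⟨l, hl, rfl⟩, _, ⟨l', hl', rfl⟩, rfl⟩
  exact ⟨l ++ l', fun j => by simp [hl, hl'], by simp⟩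

lemma mul_mem_stdGrading {i j : ℕ} {x y : ExtAlg k n} (hx : x ∈ stdGrading k n i)
    (hy : y ∈ stdGrading k n j) : x * y ∈ stdGrading k n (i + j) :=
  SetLike.GradedMul.mul_mem (A := fun i : ℕ => ⋀[k]^i (Fin n → k)) hx hy

lemma ι_mul_comm_of_mem_stdGrading (v : Fin n → k) {j : ℕ} {y : ExtAlg k n}
    (hy : y ∈ stdGrading k n j) :
    ExteriorAlgebra.ι k v * y = (-1 : ℤ) ^ j • (y * ExteriorAlgebra.ι k v) := by
  induction hy using Submodule.pow_induction_on_left' with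
  | algebraMap r => simp [Algebra.commutes]
  | add x y i hx hy ihx ihy => rw [mul_add, ihx, ihy, add_mul, smul_add]
  | mem_mul m hm i x hx ih =>
    obtain ⟨w, rfl⟩ := hm
    have hvw := eq_neg_of_add_eq_zero_left (ExteriorAlgebra.ι_add_mul_swap (R := k) v w)
    rw [← mul_assoc, hvw, neg_mul, mul_assoc, ih, mul_smul_comm, pow_succ, mul_neg_one, neg_smul,
      mul_assoc]

/-- The exterior algebra is graded commutative. -/
lemma mul_comm_of_mem_stdGrading {i j : ℕ} {x y : ExtAlg k n} (hx : x ∈ stdGrading k n i)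
    (hy : y ∈ stdGrading k n j) : x * y = (-1 : ℤ) ^ (i * j) • (y * x) := by
  induction hx using Submodule.pow_induction_on_left' with
  | algebraMap r => simp [Algebra.commutes]
  | add x z i hx hz ihx ihz => rw [mul_add, add_mul, ihx, ihz, smul_add]
  | mem_mul m hm i x hx ih =>
    obtain ⟨w, rfl⟩ := hm
    rw [mul_assoc, ih, mul_smul_comm, ← mul_assoc, ι_mul_comm_of_mem_stdGrading w hy,
      smul_mul_assoc, smul_smul, mul_assoc, ← pow_add, Nat.succ_mul]

end Monomials

/-! ### Standard monomials and the growth inequality -/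

section Standard

open Finset
open scoped FinsetFamily

variable {k : Type u} [Field k] {V : Type*} [AddCommGroup V] [Module k V]

open Classical in
/-- The rank of a finite family is the number of its members that do not lie in the span of the
preceding ones. -/
lemma finrank_span_image_eq_card_notMem_span [Module.Finite k V] {ι : Type*} [LinearOrder ι]
    (v : ι → V) (s : Finset ι) :
    Module.finrank k (Submodule.span k (v '' s)) =
      #{a ∈ s | v a ∉ Submodule.span k (v '' {b | b ∈ s ∧ b < a})} := by
  induction s using Finset.induction_on_max with
  | empty => simp
  | insert a s hs ih =>
    have ha : a ∉ s := fun h => lt_irrefl a (hs a h)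
    have h₁ : {b | b ∈ insert a s ∧ b < a} = (s : Set ι) := by
      ext b
      simp only [mem_insert, Set.mem_ofPred_eq, mem_coe]
      exact ⟨fun h => h.1.resolve_left h.2.ne, fun h => ⟨Or.inr h, hs b h⟩⟩
    have h₂ : ∀ c ∈ s, {b | b ∈ insert a s ∧ b < c} = {b | b ∈ s ∧ b < c} := by
      intro c hc
      ext b
      simp only [mem_insert, Set.mem_ofPred_eq]
      exact ⟨fun h => ⟨h.1.resolve_left (h.2.trans (hs c hc)).ne, h.2⟩,
        fun h => ⟨Or.inr h.1, h.2⟩⟩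
    have h₃ : #{c ∈ s | v c ∉ Submodule.span k (v '' {b | b ∈ insert a s ∧ b < c})} =
        Module.finrank k (Submodule.span k (v '' s)) := by
      rw [ih]
      congr 1
      exact filter_congr fun c hc => by rw [h₂ c hc]
    rw [filter_insert, h₁, coe_insert, Set.image_insert_eq, Submodule.span_insert, sup_comm]
    split_ifs with h
    · rw [h₃, sup_eq_left.2]
      simpa using h
    · rw [card_insert_of_notMem (by simp [ha]), h₃, Submodule.finrank_sup_span_singleton h]

variable {n : ℕ} {σ : Type*} [LinearOrder σ]

/-- For a family of vectors `x S l`, thought of as the products of the monomials `e_S` with the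
generators `m_l`, the span of the vectors of the same degree that strictly precede `x S l`.
Generators are compared first, monomials colexicographically. -/
def lowerSpan (k : Type u) [Field k] [Module k V] (x : Finset (Fin n) → σ → V)
    (S : Finset (Fin n)) (l : σ) : Submodule k V :=
  Submodule.span k {v | ∃ T l', #T = #S ∧ (l' < l ∨ l' = l ∧ toColex T < toColex S) ∧ v = x T l'}

/-- If multiplication by the variables acts on the family `x` as on the squarefree monomials, then
the monomials `S` for which `x S l` is not in the span of the preceding vectors are closed under
division by variables. -/
lemma notMem_lowerSpan_erase {x : Finset (Fin n) → σ → V} {φ : Fin n → V →ₗ[k] V}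
    (hmem : ∀ j S l, j ∈ S → φ j (x S l) = 0)
    (hnotMem : ∀ j S l, j ∉ S → ∃ u : ℤˣ, φ j (x S l) = u • x (insert j S) l)
    {S : Finset (Fin n)} {l : σ} {j : Fin n} (hj : j ∈ S) (hS : x S l ∉ lowerSpan k x S l) :
    x (S.erase j) l ∉ lowerSpan k x (S.erase j) l := by
  intro h
  apply hS
  obtain ⟨u, hu⟩ := hnotMem j (S.erase j) l (notMem_erase j S)
  rw [insert_erase hj] at hu
  rw [← units_smul_mem u, ← hu]
  suffices hle : (lowerSpan k x (S.erase j) l).map (φ j) ≤ lowerSpan k x S l from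
    hle (Submodule.mem_map_of_mem h)
  rw [lowerSpan, Submodule.map_span, Submodule.span_le]
  rintro _ ⟨_, ⟨T, l', hT, hlt, rfl⟩, rfl⟩
  by_cases hjT : j ∈ T
  · rw [hmem j T l' hjT]
    exact zero_mem _
  · obtain ⟨w, hw⟩ := hnotMem j T l' hjT
    rw [hw]
    refine (units_smul_mem w).2 (Submodule.subset_span ⟨insert j T, l', ?_, ?_, rfl⟩)
    · rw [card_insert_of_notMem hjT, hT, card_erase_add_one hj]
    -- adding `j` to two sets that do not contain it preserves the colexicographic order
    · refine hlt.imp_right fun h => ⟨h.1, ?_⟩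
      rw [← Colex.toColex_sdiff_lt_toColex_sdiff (u := {j}) (by simp) (by simpa using hj)]
      rw [sdiff_singleton_eq_erase, sdiff_singleton_eq_erase, erase_insert hjT]
      exact h.2

open Classical in
/-- The span of the vectors of degree `i` has the dimension given by the number of standard pairs
`(S, l)` of degree `i`, grouped by the generator `l`. -/
lemma finrank_span_eq_sum_card_notMem_lowerSpan [Module.Finite k V] [Fintype σ]
    (x : Finset (Fin n) → σ → V) (i : ℕ) :
    Module.finrank k (Submodule.span k {v | ∃ S l, #S = i ∧ v = x S l}) =
      ∑ l, #{S : Finset (Fin n) | #S = i ∧ x S l ∉ lowerSpan k x S l} := by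
  let _ : Fintype (Lex (σ × Colex (Finset (Fin n)))) :=
    Fintype.ofEquiv (σ × Finset (Fin n)) ⟨fun p => toLex (p.1, toColex p.2),
      fun p => ((ofLex p).1, ofColex (ofLex p).2), fun _ => rfl, fun _ => rfl⟩
  let v : Lex (σ × Colex (Finset (Fin n))) → V := fun p => x (ofColex (ofLex p).2) (ofLex p).1
  let s : Finset (Lex (σ × Colex (Finset (Fin n)))) := {p | #(ofColex (ofLex p).2) = i}
  have hs : {w | ∃ S l, #S = i ∧ w = x S l} = v '' s := by
    ext w
    constructor
    · rintro ⟨S, l, hS, rfl⟩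
      exact ⟨toLex (l, toColex S), by simpa [s] using hS, rfl⟩
    · rintro ⟨p, hp, rfl⟩
      exact ⟨_, _, by simpa [s] using hp, rfl⟩
  rw [hs, finrank_span_image_eq_card_notMem_span, ← card_sigma]
  refine card_bij' (fun p _ => ⟨(ofLex p).1, ofColex (ofLex p).2⟩)
    (fun q _ => toLex (q.1, toColex q.2)) ?_ ?_ (fun _ _ => rfl) (fun _ _ => rfl)
  all_goals
    have key : ∀ l S, #S = i → v '' {b | b ∈ s ∧ b < toLex (l, toColex S)} =
        {w | ∃ T l', #T = #S ∧ (l' < l ∨ l' = l ∧ toColex T < toColex S) ∧ w = x T l'} := by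
      intro l S hS
      ext w
      constructor
      · rintro ⟨b, ⟨hb, hlt⟩, rfl⟩
        rw [Prod.Lex.lt_iff] at hlt
        exact ⟨ofColex (ofLex b).2, (ofLex b).1, by simpa [s, hS] using hb, hlt, rfl⟩
      · rintro ⟨T, l', hT, hlt, rfl⟩
        refine ⟨toLex (l', toColex T), ⟨by simpa [s, ← hS] using hT, ?_⟩, rfl⟩
        rw [Prod.Lex.lt_iff]
        exact hlt
  · intro p hp
    rw [mem_filter] at hp
    have hp₁ : #(ofColex (ofLex p).2) = i := by simpa [s] using hp.1
    simp only [mem_sigma, mem_univ, mem_filter, true_and]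
    refine ⟨hp₁, ?_⟩
    rw [lowerSpan, ← key _ _ hp₁]
    exact hp.2
  · rintro ⟨l, S⟩ hq
    simp only [mem_sigma, mem_univ, mem_filter, true_and] at hq
    rw [mem_filter]
    refine ⟨by simpa [s] using hq.1, ?_⟩
    rw [key _ _ hq.1]
    exact hq.2

/-- The local LYM inequality, applied for each generator to the family of standard monomials. -/
lemma finrank_span_div_choose_le [Module.Finite k V] [Fintype σ]
    {x : Finset (Fin n) → σ → V} {φ : Fin n → V →ₗ[k] V}
    (hmem : ∀ j S l, j ∈ S → φ j (x S l) = 0)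
    (hnotMem : ∀ j S l, j ∉ S → ∃ u : ℤˣ, φ j (x S l) = u • x (insert j S) l) (i : ℕ) :
    (Module.finrank k (Submodule.span k {v | ∃ S l, #S = i + 1 ∧ v = x S l}) : ℝ) /
        n.choose (i + 1) ≤
      (Module.finrank k (Submodule.span k {v | ∃ S l, #S = i ∧ v = x S l}) : ℝ) /
        n.choose i := by
  classical
  rw [finrank_span_eq_sum_card_notMem_lowerSpan, finrank_span_eq_sum_card_notMem_lowerSpan,
    Nat.cast_sum, Nat.cast_sum, sum_div, sum_div]
  refine sum_le_sum fun l _ => ?_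
  have hsized : ((({S : Finset (Fin n) | #S = i + 1 ∧ x S l ∉ lowerSpan k x S l} :
      Finset (Finset (Fin n))) : Set (Finset (Fin n)))).Sized (i + 1) := by
    intro S hS
    simp only [coe_filter, mem_univ, true_and, Set.mem_ofPred_eq] at hS
    exact hS.1
  have := local_lubell_yamamoto_meshalkin_inequality_div (𝕜 := ℝ) i.succ_ne_zero hsized
  rw [Fintype.card_fin, Nat.succ_sub_one] at this
  refine this.trans ?_
  gcongr
  intro T hT
  obtain ⟨S, hS, j, hj, rfl⟩ := mem_shadow_iff.1 hT
  simp only [mem_filter, mem_univ, true_and] at hS ⊢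
  exact ⟨by rw [card_erase_of_mem hj, hS.1, Nat.add_sub_cancel],
    notMem_lowerSpan_erase hmem hnotMem hj hS.2⟩

end Standard

/-! ### Graded modules generated in degree zero -/

section Graded

variable {k : Type u} [Field k] {n : ℕ}

instance finite_extAlg : Module.Finite k (ExtAlg k n) :=
  Module.Finite.of_basis (monomialBasis k n)

lemma hilbertFunction_id {V : Type u} [AddCommGroup V] [Module k V] (𝓜 : ℕ → Submodule k V)
    (i : ℕ) : hilbertFunction (fun i : ℕ => i) 𝓜 i = Module.finrank k (𝓜 i) := by
  unfold hilbertFunction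
  rw [iSup_iSup_eq_left]

section Generation

variable {M : Type u} [AddCommGroup M] [Module k M] [Module (ExtAlg k n) M]
  [IsScalarTower k (ExtAlg k n) M]

lemma smul_mem_span_monomialBasis_smul {σ : Type*} {N : Submodule k M} (b : Module.Basis σ k N)
    (a : ExtAlg k n) {m : M} (hm : m ∈ N) :
    a • m ∈ Submodule.span k {v | ∃ (S : Finset (Fin n)) (l : σ),
      v = monomialBasis k n S • (b l : M)} := by
  have ha : a ∈ Submodule.span k (Set.range (monomialBasis k n)) := by
    rw [Module.Basis.span_eq]; trivial
  have hm' : (⟨m, hm⟩ : N) ∈ Submodule.span k (Set.range b) := by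
    rw [Module.Basis.span_eq]; trivial
  have hm'' := Submodule.mem_map_of_mem (f := N.subtype) hm'
  rw [Submodule.map_span] at hm''
  change m ∈ _ at hm''
  induction ha using Submodule.span_induction with
  | zero => rw [zero_smul]; exact zero_mem _
  | add x y _ _ hx hy => rw [add_smul]; exact add_mem hx hy
  | smul c x _ hx => rw [smul_assoc]; exact Submodule.smul_mem _ c hx
  | mem x hx =>
    obtain ⟨S, rfl⟩ := hx
    clear hm' hm
    induction hm'' using Submodule.span_induction with
    | zero => rw [smul_zero]; exact zero_mem _
    | add x y _ _ hx hy => rw [smul_add]; exact add_mem hx hy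
    | smul c x _ hx =>
      have : SMulCommClass (ExtAlg k n) k M := IsScalarTower.to_smulCommClass'
      rw [smul_comm]; exact Submodule.smul_mem _ c hx
    | mem y hy =>
      obtain ⟨_, ⟨l, rfl⟩, rfl⟩ := hy
      exact Submodule.subset_span ⟨S, l, rfl⟩

variable [Module (ExtAlg k n)ᵐᵒᵖ M]

/-- In a module generated in degree zero, the component of degree `i` is spanned by the products of
the monomials of degree `i` with a basis of the component of degree zero. -/
lemma IsGradedModule.eq_span_monomialBasis_smul {𝓜 : ℕ → Submodule k M}
    (h𝓜 : IsGradedModule (fun i : ℕ => i) (stdGrading k n) 𝓜)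
    (hgen : IsGeneratedInDegreeZero (n := n) 𝓜) {σ : Type*} (b : Module.Basis σ k (𝓜 0)) (i : ℕ) :
    Submodule.span k {v | ∃ (S : Finset (Fin n)) (l : σ),
      S.card = i ∧ v = monomialBasis k n S • (b l : M)} = 𝓜 i := by
  refine congrFun ((h𝓜.isInternal.submodule_iSupIndep.le_iff_eq_of_iSup_eq_top (f := fun i =>
    Submodule.span k {v | ∃ (S : Finset (Fin n)) (l : σ),
      S.card = i ∧ v = monomialBasis k n S • (b l : M)}) ?_).1 fun i => ?_) i
  rotate_left
  · rw [Submodule.span_le]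
    rintro _ ⟨S, l, rfl, rfl⟩
    exact h𝓜.smul_mem S.card 0 _ (monomialBasis_mem_stdGrading S) _ (b l).2
  · rw [eq_top_iff]
    intro x _
    have hx : x ∈ Submodule.span (ExtAlg k n) (𝓜 0 : Set M) := by
      rw [show Submodule.span (ExtAlg k n) (𝓜 0 : Set M) = ⊤ from hgen]; trivial
    induction hx using Submodule.closure_induction with
    | zero => exact zero_mem _
    | add x y _ _ hx hy => exact add_mem (hx trivial) (hy trivial)
    | smul_mem a m hm =>
      refine Submodule.span_le.2 ?_ (smul_mem_span_monomialBasis_smul b a hm)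
      rintro _ ⟨S, l, rfl⟩
      exact Submodule.mem_iSup_of_mem S.card (Submodule.subset_span ⟨S, l, rfl, rfl⟩)

lemma IsGradedModule.growthInequality {𝓜 : ℕ → Submodule k M} [Module.Finite (ExtAlg k n) M]
    (h𝓜 : IsGradedModule (fun i : ℕ => i) (stdGrading k n) 𝓜)
    (hgen : IsGeneratedInDegreeZero (n := n) 𝓜) (i : ℕ) :
    GrowthInequality n i (hilbertFunction (fun i : ℕ => i) 𝓜) := by
  have : Module.Finite k M := Module.Finite.trans (ExtAlg k n) M
  have : SMulCommClass (ExtAlg k n) k M := IsScalarTower.to_smulCommClass'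
  let b := Module.finBasis k (𝓜 0)
  have key := finrank_span_div_choose_le (k := k) (V := M) (n := n)
    (x := fun S l => monomialBasis k n S • (b l : M))
    (φ := fun j => Algebra.lsmul k k M (extVar k j)) (fun j S l hj => ?_) (fun j S l hj => ?_) i
  · rw [h𝓜.eq_span_monomialBasis_smul hgen b, h𝓜.eq_span_monomialBasis_smul hgen b] at key
    rwa [GrowthInequality, hilbertFunction_id, hilbertFunction_id]
  · change extVar k j • monomialBasis k n S • (b l : M) = 0
    rw [smul_smul, extVar_mul_monomialBasis_of_mem hj, zero_smul]
  · obtain ⟨u, hu⟩ := extVar_mul_monomialBasis_of_notMem (k := k) hj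
    refine ⟨u, ?_⟩
    change extVar k j • monomialBasis k n S • (b l : M) = _
    rw [smul_smul, hu]
    rcases Int.units_eq_one_or u with rfl | rfl <;> simp

lemma IsGradedModule.hilbertFunction_eq_zero {𝓜 : ℕ → Submodule k M}
    (h𝓜 : IsGradedModule (fun i : ℕ => i) (stdGrading k n) 𝓜)
    (hgen : IsGeneratedInDegreeZero (n := n) 𝓜) {i : ℕ} (hi : n < i) :
    hilbertFunction (fun i : ℕ => i) 𝓜 i = 0 := by
  have hbot : 𝓜 i = ⊥ := by
    rw [← h𝓜.eq_span_monomialBasis_smul hgen (Module.Free.chooseBasis k (𝓜 0)), eq_bot_iff,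
      Submodule.span_le]
    rintro _ ⟨S, l, hS, rfl⟩
    have := card_finset_fin_le S
    omega
  rw [hilbertFunction_id, hbot, finrank_bot, Nat.cast_zero]

end Generation

section Coarsening

variable {M : Type u} [AddCommGroup M] [Module k M] [Module (ExtAlg k n) M]
  [Module (ExtAlg k n)ᵐᵒᵖ M]

/-- Collecting the components of an `ℕⁿ`-graded module by total degree gives an `ℕ`-graded
module. -/
lemma IsGradedModule.coarsen {𝓜 : (Fin n → ℕ) → Submodule k M}
    (h𝓜 : IsGradedModule (totalDegree n) (fineGrading k n) 𝓜) :
    IsGradedModule (fun i : ℕ => i) (stdGrading k n)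
      fun i => ⨆ (a : Fin n → ℕ) (_ : totalDegree n a = i), 𝓜 a where
  isInternal := by
    refine DirectSum.isInternal_submodule_of_iSupIndep_of_iSup_eq_top ?_ ?_
    · intro i
      have hind := h𝓜.isInternal.submodule_iSupIndep
      have := hind.disjoint_biSup_biSup (s := {a | totalDegree n a = i})
        (t := {a | totalDegree n a ≠ i})
        (Set.disjoint_left.2 fun a h h' => h' h)
      refine this.mono le_rfl (iSup₂_le fun j hj => iSup₂_le fun a ha => ?_)
      exact le_iSup₂_of_le a (by rw [Set.mem_ofPred_eq, ha]; exact hj) le_rfl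
    · rw [eq_top_iff, ← h𝓜.isInternal.submodule_iSup_eq_top]
      exact iSup_le fun a => le_iSup_of_le (totalDegree n a) (le_iSup₂_of_le a rfl le_rfl)
  smul_mem := by
    intro i j a ha m hm
    replace ha := stdGrading_le_iSup_fineGrading i ha
    rw [iSup_subtype'] at ha hm
    induction ha using Submodule.iSup_induction' with
    | zero => rw [zero_smul]; exact zero_mem _
    | add x y _ _ hx hy => rw [add_smul]; exact add_mem hx hy
    | mem g x hx =>
      induction hm using Submodule.iSup_induction' with
      | zero => rw [smul_zero]; exact zero_mem _
      | add x y _ _ hx hy => rw [smul_add]; exact add_mem hx hy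
      | mem h m hm =>
        have hdeg : totalDegree n (g.1 + h.1) = i + j := by
          have hg := g.2
          have hh := h.2
          simp only [totalDegree, Pi.add_apply, Finset.sum_add_distrib] at hg hh ⊢
          rw [hg, hh]
        exact Submodule.mem_iSup_of_mem (g.1 + h.1) (Submodule.mem_iSup_of_mem hdeg
          (h𝓜.smul_mem _ _ _ hx _ hm))
  smul_comm := by
    intro i j a ha m hm
    replace ha := stdGrading_le_iSup_fineGrading i ha
    rw [iSup_subtype'] at ha hm
    induction ha using Submodule.iSup_induction' with
    | zero => simp
    | add x y _ _ hx hy => rw [add_smul, hx, hy, op_add, add_smul, smul_add]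
    | mem g x hx =>
      induction hm using Submodule.iSup_induction' with
      | zero => simp
      | add x y _ _ hx hy => rw [smul_add, hx, hy, smul_add, smul_add]
      | mem h m hm =>
        have := h𝓜.smul_comm _ _ _ hx _ hm
        rwa [g.2, h.2] at this

end Coarsening

lemma totalDegree_zero : totalDegree n 0 = 0 := by simp [totalDegree]

lemma hilbertFunctions_fineGrading_subset :
    hilbertFunctions (totalDegree n) (fineGrading k n) ⊆
      hilbertFunctions (fun i : ℕ => i) (stdGrading k n) := by
  rintro _ ⟨M, i₁, i₂, i₃, i₄, i₅, 𝓜, h𝓜, hfin, hgen, rfl⟩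
  refine ⟨M, i₁, i₂, i₃, i₄, i₅, _, h𝓜.coarsen, hfin, ?_, ?_⟩
  · rw [IsGeneratedInDegreeZero, eq_top_iff]
    refine le_trans (show (⊤ : Submodule (ExtAlg k n) M) ≤ _ from hgen.ge) (Submodule.span_mono ?_)
    exact le_iSup₂_of_le (f := fun a (_ : totalDegree n a = 0) => 𝓜 a) 0 totalDegree_zero le_rfl
  · funext i
    rw [hilbertFunction_id]
    rfl

lemma hilbertFunctions_stdGrading_subset :
    hilbertFunctions (fun i : ℕ => i) (stdGrading k n) ⊆
      {h | (∀ i, n < i → h i = 0) ∧ 0 ≤ h n ∧ ∀ i < n, GrowthInequality n i h} := by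
  rintro _ ⟨M, i₁, i₂, i₃, i₄, i₅, 𝓜, h𝓜, hfin, hgen, rfl⟩
  exact ⟨fun i hi => h𝓜.hilbertFunction_eq_zero hgen hi, Nat.cast_nonneg _,
    fun i _ => h𝓜.growthInequality hgen i⟩

end Graded

/-! ### The cone cut out by the growth inequalities -/

section Cone

open Finset

/-- The Hilbert function of the exterior algebra truncated above degree `d`. -/
def truncatedBinomial (n d : ℕ) : ℕ → ℝ := fun i => if i ≤ d then (n.choose i : ℝ) else 0

/-- The sequence `h(d) / C(n,d)` minus its successor, as a linear functional of `h`.  For `d = n`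
the second term is a division by `C(n,n+1) = 0`, hence zero. -/
noncomputable def growthDefect (n d : ℕ) : Module.Dual ℝ (ℕ → ℝ) :=
  (n.choose d : ℝ)⁻¹ • LinearMap.proj d - (n.choose (d + 1) : ℝ)⁻¹ • LinearMap.proj (d + 1)

lemma growthDefect_apply (n d : ℕ) (h : ℕ → ℝ) :
    growthDefect n d h = h d / n.choose d - h (d + 1) / n.choose (d + 1) := by
  simp [growthDefect, div_eq_inv_mul]

lemma truncatedBinomial_div_choose {n i : ℕ} (hi : i ≤ n) (d : ℕ) :
    truncatedBinomial n d i / n.choose i = if i ≤ d then 1 else 0 := by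
  have : (n.choose i : ℝ) ≠ 0 := by exact_mod_cast (Nat.choose_pos hi).ne'
  unfold truncatedBinomial
  split_ifs <;> simp [this]

lemma growthDefect_truncatedBinomial {n d e : ℕ} (hd : d ≤ n) (he : e ≤ n) :
    growthDefect n d (truncatedBinomial n e) = if d = e then 1 else 0 := by
  rw [growthDefect_apply, truncatedBinomial_div_choose hd]
  rcases hd.eq_or_lt with rfl | hd'
  · rw [Nat.choose_succ_self, Nat.cast_zero, div_zero, sub_zero]
    exact if_congr (by omega) rfl rfl
  · rw [truncatedBinomial_div_choose hd']
    split_ifs <;> first | omega | norm_num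

lemma linearIndependent_truncatedBinomial (n : ℕ) :
    LinearIndependent ℝ fun d : Fin (n + 1) => truncatedBinomial n d :=
  LinearIndependent.of_pairwise_dual_eq_zero_one _ (fun d => growthDefect n d)
    (fun d e hde => by
      beta_reduce
      rw [growthDefect_truncatedBinomial d.is_le e.is_le, if_neg (fun h => hde (Fin.ext h))])
    (fun d => by rw [growthDefect_truncatedBinomial d.is_le d.is_le, if_pos rfl])

/-- The cone of the sequences that vanish above degree `n`, are non-negative in degree `n`, and
satisfy the growth inequalities. -/
def growthCone (n : ℕ) : PointedCone ℝ (ℕ → ℝ) where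
  carrier := {h | (∀ i, n < i → h i = 0) ∧ 0 ≤ h n ∧ ∀ i < n, GrowthInequality n i h}
  zero_mem' := by simp [GrowthInequality]
  add_mem' := by
    rintro f g ⟨hf₁, hf₂, hf₃⟩ ⟨hg₁, hg₂, hg₃⟩
    refine ⟨fun i hi => by simp [hf₁ i hi, hg₁ i hi], add_nonneg hf₂ hg₂, fun i hi => ?_⟩
    have := add_le_add (hf₃ i hi) (hg₃ i hi)
    simpa only [GrowthInequality, Pi.add_apply, add_div] using this
  smul_mem' := by
    rintro ⟨c, hc⟩ f ⟨hf₁, hf₂, hf₃⟩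
    change ((∀ i, n < i → c * f i = 0) ∧ 0 ≤ c * f n ∧ ∀ i < n,
      c * f (i + 1) / n.choose (i + 1) ≤ c * f i / n.choose i)
    refine ⟨fun i hi => by simp [hf₁ i hi], mul_nonneg hc hf₂, fun i hi => ?_⟩
    rw [mul_div_assoc, mul_div_assoc]
    exact mul_le_mul_of_nonneg_left (hf₃ i hi) hc

lemma mem_growthCone {n : ℕ} {h : ℕ → ℝ} : h ∈ growthCone n ↔
    (∀ i, n < i → h i = 0) ∧ 0 ≤ h n ∧ ∀ i < n, GrowthInequality n i h := Iff.rfl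

/-- Summation by parts: a sequence vanishing above degree `n` is a combination of truncated rows of
Pascal's triangle, with its growth defects as coefficients. -/
lemma eq_sum_growthDefect_smul {n : ℕ} {h : ℕ → ℝ} (hh : ∀ i, n < i → h i = 0) :
    h = ∑ d ∈ range (n + 1), growthDefect n d h • truncatedBinomial n d := by
  funext i
  rw [Finset.sum_apply]
  simp only [Pi.smul_apply, smul_eq_mul]
  rcases lt_or_ge n i with hi | hi
  · rw [hh i hi]
    refine (sum_eq_zero fun d hd => ?_).symm
    have : ¬ i ≤ d := by have := mem_range.1 hd; omega
    simp [truncatedBinomial, this]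
  · have hc : (n.choose i : ℝ) ≠ 0 := by exact_mod_cast (Nat.choose_pos hi).ne'
    have hterm : ∀ d ∈ range (n + 1), growthDefect n d h * truncatedBinomial n d i =
        if d ∈ Ico i (n + 1) then growthDefect n d h * n.choose i else 0 := by
      intro d hd
      have := mem_range.1 hd
      simp [truncatedBinomial, this]
    have hfilter : {d ∈ range (n + 1) | d ∈ Ico i (n + 1)} = Ico i (n + 1) := by
      ext d; simp
    rw [sum_congr rfl hterm, ← sum_filter, hfilter, ← sum_mul]
    have htel : ∑ d ∈ Ico i (n + 1), growthDefect n d h = h i / n.choose i := by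
      have := sum_Ico_sub (fun d => - (h d / n.choose d : ℝ)) (Nat.le_succ_of_le hi)
      simp only [neg_sub_neg, ← growthDefect_apply] at this
      rw [this, Nat.succ_eq_add_one, hh (n + 1) n.lt_succ_self, zero_div, sub_zero]
    rw [htel, div_mul_cancel₀ _ hc]

lemma growthDefect_nonneg {n d : ℕ} {h : ℕ → ℝ} (hh : h ∈ growthCone n) (hd : d ≤ n) :
    0 ≤ growthDefect n d h := by
  rw [growthDefect_apply]
  rcases hd.eq_or_lt with rfl | hd
  · simpa using hh.2.1
  · exact sub_nonneg.2 (hh.2.2 d hd)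

lemma growthCone_le_hull (n : ℕ) : growthCone n ≤
    PointedCone.hull ℝ (Set.range fun d : Fin (n + 1) => truncatedBinomial n d) := by
  intro h hh
  rw [eq_sum_growthDefect_smul hh.1]
  refine Submodule.sum_mem _ fun d hd => ?_
  have hd : d < n + 1 := mem_range.1 hd
  exact PointedCone.smul_mem _ (growthDefect_nonneg hh (Nat.lt_succ_iff.1 hd))
    (PointedCone.subset_hull ⟨⟨d, hd⟩, rfl⟩)

/-- The sequence that agrees with the row of Pascal's triangle above degree `i` and vanishes up to
degree `i` violates the `i`-th growth inequality only. -/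
lemma exists_notMem_growthCone {n i : ℕ} (hi : i < n) :
    ∃ h : ℕ → ℝ, (∀ j, n < j → h j = 0) ∧ (∀ j, 0 ≤ h j) ∧
      (∀ j < n, j ≠ i → GrowthInequality n j h) ∧ h ∉ growthCone n := by
  have hdiv : ∀ j ≤ n, (if i < j then (n.choose j : ℝ) else 0) / n.choose j =
      if i < j then 1 else 0 := by
    intro j hj
    have : (n.choose j : ℝ) ≠ 0 := by exact_mod_cast (Nat.choose_pos hj).ne'
    split_ifs <;> simp [this]
  refine ⟨fun j => if i < j then (n.choose j : ℝ) else 0, fun j hj => ?_, fun j => ?_,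
    fun j hj hji => ?_, fun h => ?_⟩
  · simp [Nat.choose_eq_zero_of_lt hj]
  · dsimp only
    split_ifs <;> positivity
  · rw [GrowthInequality, hdiv _ hj, hdiv _ hj.le]
    split_ifs <;> first | omega | norm_num
  · have := h.2.2 i hi
    rw [GrowthInequality, hdiv _ hi, hdiv _ hi.le] at this
    norm_num at this

end Cone

/-! ### Truncations of the exterior algebra -/

section Truncation

variable {k : Type u} [Field k] {n : ℕ}

/-- If every member of a basis has a weight, then the spans of the members of equal weight form a
direct sum decomposition. -/
lemma isInternal_span_image_fiber {ι V G : Type*} [AddCommGroup V] [Module k V] [DecidableEq G]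
    (b : Module.Basis ι k V) (w : ι → G) :
    DirectSum.IsInternal fun g => Submodule.span k (b '' {i | w i = g}) := by
  refine DirectSum.isInternal_submodule_of_iSupIndep_of_iSup_eq_top (fun g => ?_) ?_
  · refine (b.linearIndependent.disjoint_span_image (s := {i | w i = g}) (t := {i | w i ≠ g})
      (Set.disjoint_left.2 fun i h h' => h' h)).mono le_rfl (iSup₂_le fun h hh => ?_)
    refine Submodule.span_mono (Set.image_mono fun i hi => ?_)
    rw [Set.mem_ofPred_eq] at hi ⊢
    rwa [hi]
  · rw [eq_top_iff, ← b.span_eq, Submodule.span_le]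
    rintro _ ⟨i, rfl⟩
    exact Submodule.mem_iSup_of_mem (w i) (Submodule.subset_span ⟨i, rfl, rfl⟩)

/-- The two-sided ideal of the exterior algebra spanned by the monomials of degree greater
than `d`. -/
noncomputable def truncationIdeal (k : Type u) [Field k] (n d : ℕ) : Ideal (ExtAlg k n) where
  __ := Submodule.span k (monomialBasis k n '' {S | d < S.card})
  smul_mem' a x hx := by
    change x ∈ Submodule.span k _ at hx
    change a * x ∈ Submodule.span k _
    induction hx using Submodule.span_induction with
    | zero => rw [mul_zero]; exact zero_mem _
    | add x y _ _ hx hy => rw [mul_add]; exact add_mem hx hy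
    | smul c x _ hx => rw [mul_smul_comm]; exact Submodule.smul_mem _ c hx
    | mem x hx =>
      obtain ⟨S, hS, rfl⟩ := hx
      have ha : a ∈ Submodule.span k (Set.range (monomialBasis k n)) := by
        rw [Module.Basis.span_eq]; trivial
      induction ha using Submodule.span_induction with
      | zero => rw [zero_mul]; exact zero_mem _
      | add x y _ _ hx hy => rw [add_mul]; exact add_mem hx hy
      | smul c x _ hx => rw [smul_mul_assoc]; exact Submodule.smul_mem _ c hx
      | mem x hx =>
        obtain ⟨T, rfl⟩ := hx
        have h := mul_mem_stdGrading (monomialBasis_mem_stdGrading (k := k) T)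
          (monomialBasis_mem_stdGrading S)
        rw [stdGrading_eq_span] at h
        refine Submodule.span_mono (Set.image_mono fun U hU => ?_) h
        rw [Set.mem_ofPred_eq] at hU hS ⊢
        omega

lemma mem_truncationIdeal {d : ℕ} {x : ExtAlg k n} : x ∈ truncationIdeal k n d ↔
    x ∈ Submodule.span k (monomialBasis k n '' {S | d < S.card}) := Iff.rfl

instance truncationIdeal_isTwoSided (d : ℕ) : (truncationIdeal k n d).IsTwoSided where
  mul_mem_of_left {x} a hx := by
    rw [mem_truncationIdeal] at hx
    induction hx using Submodule.span_induction with
    | zero => rw [zero_mul]; exact zero_mem _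
    | add x y _ _ hx hy => rw [add_mul]; exact add_mem hx hy
    | smul c x _ hx =>
      rw [smul_mul_assoc, mem_truncationIdeal]
      exact Submodule.smul_mem _ c hx
    | mem x hx =>
      obtain ⟨S, hS, rfl⟩ := hx
      have ha : a ∈ Submodule.span k (Set.range (monomialBasis k n)) := by
        rw [Module.Basis.span_eq]; trivial
      induction ha using Submodule.span_induction with
      | zero => rw [mul_zero]; exact zero_mem _
      | add x y _ _ hx hy => rw [mul_add]; exact add_mem hx hy
      | smul c x _ hx =>
        rw [mul_smul_comm, mem_truncationIdeal]
        exact Submodule.smul_mem _ c hx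
      | mem x hx =>
        obtain ⟨T, rfl⟩ := hx
        -- graded commutativity reduces this to the closure under left multiplication
        rw [mul_comm_of_mem_stdGrading (monomialBasis_mem_stdGrading S)
          (monomialBasis_mem_stdGrading T)]
        exact zsmul_mem (Ideal.mul_mem_left _ _
          (mem_truncationIdeal.2 (Submodule.subset_span ⟨S, hS, rfl⟩))) _

/-- The quotient map from the exterior algebra to its truncation above degree `d`, as a linear
map. -/
noncomputable def truncationMap (k : Type u) [Field k] (n d : ℕ) :
    ExtAlg k n →ₗ[k] ExtAlg k n ⧸ truncationIdeal k n d :=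
  (truncationIdeal k n d).mkQ.restrictScalars k

lemma truncationMap_eq_zero {d : ℕ} {x : ExtAlg k n} :
    truncationMap k n d x = 0 ↔ x ∈ truncationIdeal k n d :=
  Submodule.Quotient.mk_eq_zero _

lemma ker_truncationMap (d : ℕ) : LinearMap.ker (truncationMap k n d) =
    Submodule.span k (monomialBasis k n '' {S | d < S.card}) := by
  ext x
  rw [LinearMap.mem_ker, truncationMap_eq_zero, mem_truncationIdeal]

/-- The basis of the truncation formed by the classes of the monomials of degree at most `d`. -/
noncomputable def truncationBasis (k : Type u) [Field k] (n d : ℕ) :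
    Module.Basis {S : Finset (Fin n) // S.card ≤ d} k (ExtAlg k n ⧸ truncationIdeal k n d) :=
  .mk (v := fun S => truncationMap k n d (monomialBasis k n S))
    (by
      refine ((monomialBasis k n).linearIndependent.comp _ Subtype.val_injective).map ?_
      rw [ker_truncationMap, Set.range_comp]
      refine (monomialBasis k n).linearIndependent.disjoint_span_image ?_
      refine Set.disjoint_left.2 ?_
      rintro _ ⟨S, rfl⟩ h
      exact not_lt.2 S.2 h)
    (by
      intro x _
      obtain ⟨y, rfl⟩ := Submodule.Quotient.mk_surjective _ x
      have hy : y ∈ Submodule.span k (Set.range (monomialBasis k n)) := by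
        rw [Module.Basis.span_eq]; trivial
      change truncationMap k n d y ∈ _
      refine (Submodule.map_span_le _ _ _).2 ?_ (Submodule.mem_map_of_mem hy)
      rintro _ ⟨S, rfl⟩
      by_cases hS : S.card ≤ d
      · exact Submodule.subset_span ⟨⟨S, hS⟩, rfl⟩
      · rw [truncationMap_eq_zero.2 (mem_truncationIdeal.2
          (Submodule.subset_span ⟨S, not_le.1 hS, rfl⟩))]
        exact zero_mem _)

lemma truncationBasis_apply {d : ℕ} (S : {S : Finset (Fin n) // S.card ≤ d}) :
    truncationBasis k n d S = truncationMap k n d (monomialBasis k n S) := by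
  rw [truncationBasis, Module.Basis.mk_apply]

lemma map_truncationMap_fineGrading (d : ℕ) (a : Fin n → ℕ) :
    (fineGrading k n a).map (truncationMap k n d) =
      Submodule.span k (truncationBasis k n d '' {S | fineDegree S.1 = a}) := by
  rw [fineGrading_eq_span]
  apply le_antisymm
  · rw [Submodule.map_span_le]
    rintro _ ⟨S, hS, rfl⟩
    by_cases hd : S.card ≤ d
    · exact Submodule.subset_span ⟨⟨S, hd⟩, hS, truncationBasis_apply _⟩
    · rw [truncationMap_eq_zero.2 (mem_truncationIdeal.2
        (Submodule.subset_span ⟨S, not_le.1 hd, rfl⟩))]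
      exact zero_mem _
  · rw [Submodule.span_le]
    rintro _ ⟨S, hS, rfl⟩
    rw [truncationBasis_apply]
    exact Submodule.mem_map_of_mem (Submodule.subset_span ⟨S.1, hS, rfl⟩)

lemma hilbertFunction_truncation (d : ℕ) :
    hilbertFunction (totalDegree n)
      (fun a => (fineGrading k n a).map (truncationMap k n d)) = truncatedBinomial n d := by
  funext i
  have hspan : ⨆ (a : Fin n → ℕ) (_ : totalDegree n a = i),
      (fineGrading k n a).map (truncationMap k n d) = Submodule.span k (Set.range
        fun S : {S : {S : Finset (Fin n) // S.card ≤ d} // S.1.card = i} =>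
          truncationBasis k n d S) := by
    simp only [map_truncationMap_fineGrading]
    apply le_antisymm
    · refine iSup₂_le fun a ha => Submodule.span_mono ?_
      rintro _ ⟨S, hS, rfl⟩
      refine ⟨⟨S, ?_⟩, rfl⟩
      rw [← totalDegree_fineDegree, show fineDegree S.1 = a from hS, ha]
    · rw [Submodule.span_le]
      rintro _ ⟨S, rfl⟩
      exact Submodule.mem_iSup_of_mem (fineDegree S.1.1) (Submodule.mem_iSup_of_mem
        ((totalDegree_fineDegree _).trans S.2) (Submodule.subset_span ⟨S.1, rfl, rfl⟩))
  unfold hilbertFunction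
  have hli : LinearIndependent k
      fun S : {S : {S : Finset (Fin n) // S.card ≤ d} // S.1.card = i} => truncationBasis k n d S :=
    (truncationBasis k n d).linearIndependent.comp _ Subtype.val_injective
  rw [hspan, finrank_span_eq_card hli, truncatedBinomial]
  split_ifs with hi
  · rw [← Fintype.card_congr (Equiv.subtypeSubtypeEquivSubtype
      (p := fun S : Finset (Fin n) => S.card ≤ d) (q := fun S => S.card = i)
      (fun h => h.trans_le hi)).symm, Fintype.card_finset_len, Fintype.card_fin]
  · rw [Nat.cast_eq_zero, Fintype.card_eq_zero_iff]
    exact ⟨fun S => hi (S.2 ▸ S.1.2)⟩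

/-- The truncation of the exterior algebra above degree `d` is a quotient by a two-sided ideal
that is homogeneous for the `ℕⁿ`-grading; its Hilbert function is a truncated row of Pascal's
triangle. -/
lemma truncatedBinomial_mem_hilbertFunctions (d : ℕ) :
    truncatedBinomial n d ∈ hilbertFunctions (totalDegree n) (fineGrading k n) := by
  let f : (ExtAlg k n)ᵐᵒᵖ →+* (ExtAlg k n ⧸ truncationIdeal k n d)ᵐᵒᵖ :=
    (Ideal.Quotient.mk (truncationIdeal k n d)).op
  let _ : Module (ExtAlg k n)ᵐᵒᵖ (ExtAlg k n ⧸ truncationIdeal k n d) := Module.compHom _ f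
  refine ⟨ExtAlg k n ⧸ truncationIdeal k n d, inferInstance, inferInstance, inferInstance,
    inferInstance, inferInstance, fun a => (fineGrading k n a).map (truncationMap k n d),
    ⟨?_, ?_, ?_⟩, inferInstance, ?_, (hilbertFunction_truncation d).symm⟩
  · simp only [map_truncationMap_fineGrading]
    exact isInternal_span_image_fiber (truncationBasis k n d) fun S => fineDegree S.1
  · rintro g h a ha _ ⟨m, hm, rfl⟩
    exact ⟨a * m, mul_mem_fineGrading ha hm, rfl⟩
  · rintro g h a ha _ ⟨m, hm, rfl⟩
    have := congrArg (truncationMap k n d) (mul_comm_of_mem_stdGrading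
      (fineGrading_le_stdGrading g ha) (fineGrading_le_stdGrading h hm))
    rw [map_zsmul] at this
    exact this
  · rw [IsGeneratedInDegreeZero, eq_top_iff]
    intro x _
    obtain ⟨y, rfl⟩ := Submodule.Quotient.mk_surjective _ x
    have h1 : (1 : ExtAlg k n) ∈ fineGrading k n 0 :=
      Submodule.subset_span ⟨[], by simp, by simp⟩
    have := Submodule.smul_mem _ y (Submodule.subset_span (R := ExtAlg k n)
      (Submodule.mem_map_of_mem (f := truncationMap k n d) h1))
    convert this using 1
    change _ = truncationMap k n d (y * 1)
    rw [mul_one]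
    rfl

end Truncation

/-! ### Comparison of the cones -/

theorem mainTheorem6 (k : Type u) [Field k] (n : ℕ) :
    -- the `ℕ`-graded and the `ℕⁿ`-graded modules have the same cone, and it is simplicial
    fineHilbertCone k n = hilbertCone k n ∧
    (hilbertCone k n).IsSimplicial ∧
    -- description by inequalities inside the sequences supported in degrees `0, …, n`
    (∀ h : ℕ → ℝ, h ∈ hilbertCone k n ↔
      (∀ i, n < i → h i = 0) ∧ 0 ≤ h n ∧ ∀ i < n, GrowthInequality n i h) ∧
    -- none of the growth inequalities can be omitted, even among non-negative sequences
    (∀ i < n, ∃ h : ℕ → ℝ, (∀ j, n < j → h j = 0) ∧ (∀ j, 0 ≤ h j) ∧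
      (∀ j < n, j ≠ i → GrowthInequality n j h) ∧ h ∉ hilbertCone k n) := by
  -- all four cones in the following chain of inclusions coincide
  have h₁ : PointedCone.hull ℝ (Set.range fun d : Fin (n + 1) => truncatedBinomial n d) ≤
      fineHilbertCone k n := by
    refine Submodule.span_mono ?_
    rintro _ ⟨d, rfl⟩
    exact truncatedBinomial_mem_hilbertFunctions _
  have h₂ : fineHilbertCone k n ≤ hilbertCone k n :=
    Submodule.span_mono hilbertFunctions_fineGrading_subset
  have h₃ : hilbertCone k n ≤ growthCone n :=
    Submodule.span_le.2 hilbertFunctions_stdGrading_subset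
  have h₄ := growthCone_le_hull n
  have heq : hilbertCone k n = growthCone n := le_antisymm h₃ (h₄.trans (h₁.trans h₂))
  refine ⟨le_antisymm h₂ (h₃.trans (h₄.trans h₁)), ?_, fun h => ?_, fun i hi => ?_⟩
  · rw [heq, le_antisymm h₄ (h₁.trans (h₂.trans h₃))]
    exact .hull (Set.finite_range _) (linearIndependent_truncatedBinomial n).linearIndepOn_id
  · rw [heq, mem_growthCone]
  · rw [heq]
    exact exists_notMem_growthCone hi
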